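/- For a finite group $G$ let $\mu(G)$ be the least $n\ge 0$ such that $G$ embeds in $\mathrm{Sym}(n)$. Let $p$ and $q$ be distinct odd primes, let $C_p$ be the cyclic group of order $p$ with a fixed generator $g$, and let $W=C_p\wr \mathrm{Sym}(q)=C_p^{\,q}\rtimes \mathrm{Sym}(q)$, where $\mathrm{Sym}(q)$ permutes the coordinates. Let $\gamma_i$ be the element of the base group $C_p^{\,q}$ with $i$-th coordinate $g$ and all other coordinates trivial, and put $\gamma=\gamma_1\gamma_2\cdots\gamma_q$. Let $G(p,p,q)=A\rtimes\mathrm{Sym}(q)\le W$, where $A=\{(\theta_1,\dots,\theta_q)\in C_p^{\,q} : \theta_1\cdots\theta_q=1\}$. (1) The subgroup $\langle\gamma\rangle$ is central in $W$, is isomorphic to $C_p$, and is the centralizer of $G(p,p,q)$ in $W$. The group $W$ is the internal direct product of $\langle\gamma\rangle$ and $G(p,p,q)$. (2) $\mu(W)=\mu(\langle\gamma\rangle\times G(p,p,q))=pq$ and $\mu(\langle\gamma\rangle)=p$. (3) If it is not the case that both $q=3$ and $p\equiv 1 \pmod 3$, then also $\mu(G(p,p,q))=pq$. Consequently $$\mu(\langle\gamma\rangle\times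 G(p,p,q)) = pq < p+pq=\mu(\langle\gamma\rangle)+\mu(G(p,p,q)).$$ -/

import Mathlib

/-- The minimal degree of a (finite) group: the least `n` such that `G` embeds in `Sym(n)`. -/
noncomputable def minDegree (G : Type*) [Group G] : ℕ :=
  sInf {n : ℕ | ∃ f : G →* Equiv.Perm (Fin n), Function.Injective f}

/-- For a finite group the minimal degree is attained (so `sInf` takes no junk value). -/
theorem minDegree_isLeast (G : Type*) [Group G] [Finite G] :
    IsLeast {n : ℕ | ∃ f : G →* Equiv.Perm (Fin n), Function.Injective f} (minDegree G) := by
  have hne : {n : ℕ | ∃ f : G →* Equiv.Perm (Fin n), Function.Injective f}.Nonempty := by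
    refine ⟨Nat.card G, (Finite.equivFin G).permCongrHom.toMonoidHom.comp
      (MulAction.toPermHom G G), ?_⟩
    exact (Finite.equivFin G).permCongrHom.injective.comp MulAction.toPerm_injective
  exact ⟨Nat.sInf_mem hne, fun _ hn => Nat.sInf_le hn⟩

/-- The cyclic group `C_m` of order `m`, written multiplicatively. -/
abbrev Cyc (m : ℕ) : Type := Multiplicative (ZMod m)

/-- The wreath product `C_m ≀ Sym(n)`: the semidirect product of the base group `C_m ^ n` by
`Sym(n)` permuting the coordinates, `(σ • θ) i = θ (σ⁻¹ i)`. -/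
abbrev Wreath (m n : ℕ) : Type :=
  (Fin n → Cyc m) ⋊[mulAutArrow (G := Equiv.Perm (Fin n)) (A := Fin n) (M := Cyc m)]
    Equiv.Perm (Fin n)

/-- The subgroup `A(m,p,n) = {θ : (θ₁ ⋯ θₙ) ^ (m / p) = 1}` of the base group `C_m ^ n`. -/
def baseA (m p n : ℕ) : Subgroup (Fin n → Cyc m) where
  carrier := {θ | (∏ i, θ i) ^ (m / p) = 1}
  one_mem' := by simp
  mul_mem' := by
    intro a b ha hb
    simp only [Set.mem_ofPred_eq] at ha hb ⊢
    simp [Finset.prod_mul_distrib, mul_pow, ha, hb]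
  inv_mem' := by
    intro a ha
    simp only [Set.mem_ofPred_eq] at ha ⊢
    simp [ha]

/-- `A(m,p,n)` is stable under permutation of the coordinates. -/
theorem mulAutArrow_mem_baseA {m p n : ℕ} (σ : Equiv.Perm (Fin n)) {θ : Fin n → Cyc m}
    (h : θ ∈ baseA m p n) :
    mulAutArrow (G := Equiv.Perm (Fin n)) (A := Fin n) (M := Cyc m) σ θ ∈ baseA m p n := by
  change (∏ i, θ (σ⁻¹ i)) ^ (m / p) = 1
  rw [Equiv.prod_comp σ⁻¹ θ]
  exact h

/-- The group `G(m,p,n) = A(m,p,n) ⋊ Sym(n)`, as the subgroup of `C_m ≀ Sym(n)` of all pairs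
`(θ, σ)` with `θ ∈ A(m,p,n)`. -/
def reflGroup (m p n : ℕ) : Subgroup (Wreath m n) where
  carrier := {w | w.left ∈ baseA m p n}
  one_mem' := (baseA m p n).one_mem
  mul_mem' := by
    intro a b ha hb
    exact (baseA m p n).mul_mem ha (mulAutArrow_mem_baseA a.right hb)
  inv_mem' := by
    intro a ha
    exact mulAutArrow_mem_baseA a.right⁻¹ ((baseA m p n).inv_mem ha)

/-- The generator `γᵢ` of the `i`-th factor of the base group of `C_m ≀ Sym(n)`. -/
def gen (m n : ℕ) (i : Fin n) : Fin n → Cyc m :=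
  Pi.mulSingle i (Multiplicative.ofAdd (1 : ZMod m))

/-- The element `γ = γ₁ γ₂ ⋯ γₙ` of `C_m ≀ Sym(n)`. -/
def gammaProd (m n : ℕ) : Wreath m n :=
  SemidirectProduct.inl (∏ i, gen m n i)

/-- `G` is the internal direct product of its subgroups `H` and `K`. -/
def IsInternalDirectProduct {G : Type*} [Group G] (H K : Subgroup G) : Prop :=
  H.Normal ∧ K.Normal ∧ H ⊓ K = ⊥ ∧ H ⊔ K = ⊤

/-! `W` acts faithfully on `q` copies of `C_p`, so `p * q` bounds every degree here from above. For
`W` it is also a lower bound: the base group is abelian of order `p ^ q`, and such a group needs `p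
* q` points (`mul_le_card_of_commute`). The direct decomposition comes from the product of
coordinates `W → C_p`: its kernel is `G(p,p,q)`, and on the diagonal `⟨γ⟩` it is `c ↦ c ^ q`,
bijective since `p ≠ q`.

For `G(p,p,q)` the abelian bound gives only `p * (q - 1)`. Instead, let `H` be the stabilizer of a
point moved by `A`; its index is `[A : H ∩ A]` times the index of its image in `Sym(q)`. If the
image has index at least `q`, the first factor is at least `p`. Otherwise the image contains
`Alt(q)` (`alternatingGroup_le_of_index_lt_prime`), under which `A` is irreducible
(`mem_of_alternating_invariant_zmod`); so `H ∩ A` is trivial and the first factor alone is at least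
`p ^ (q - 1) ≥ p * q`. -/

/-! ### Minimal degrees and abelian `p`-groups. -/

theorem minDegree_le_card {G X : Type*} [Group G] [Finite G] [Finite X]
    (f : G →* Equiv.Perm X) (hf : Function.Injective f) : minDegree G ≤ Nat.card X :=
  (minDegree_isLeast G).2 ⟨(Finite.equivFin X).permCongrHom.toMonoidHom.comp f,
    (Finite.equivFin X).permCongrHom.injective.comp hf⟩

theorem minDegree_le_of_injective {G H : Type*} [Group G] [Group H] [Finite H]
    (f : G →* H) (hf : Function.Injective f) : minDegree G ≤ minDegree H := by
  have : Finite G := Finite.of_injective f hf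
  obtain ⟨g, hg⟩ := (minDegree_isLeast H).1
  exact (minDegree_isLeast G).2 ⟨g.comp f, hg.comp hf⟩

theorem minDegree_congr {G H : Type*} [Group G] [Group H] [Finite H] (e : G ≃* H) :
    minDegree G = minDegree H := by
  have : Finite G := Finite.of_injective e e.injective
  exact le_antisymm (minDegree_le_of_injective e.toMonoidHom e.injective)
    (minDegree_le_of_injective e.symm.toMonoidHom e.symm.injective)

/-- A commutative permutation group of order `p ^ k` moves at least `p * k` points. -/
theorem mul_le_card_of_commute {α : Type*} {p : ℕ} (hp : p.Prime) (S : Finset α) :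
    ∀ (H : Subgroup (Equiv.Perm α)), (∀ a ∈ H, ∀ b ∈ H, a * b = b * a) →
      (∀ h ∈ H, ∀ x ∉ S, h x = x) → ∀ k : ℕ, Nat.card H = p ^ k → p * k ≤ S.card := by
  classical
  induction S using Finset.strongInduction with
  | H S ih =>
    intro H hc hf k hk
    rcases Nat.eq_zero_or_pos k with rfl | hk0
    · simp
    have hfin : Finite H := Nat.finite_of_card_ne_zero (by rw [hk]; exact (pow_pos hp.pos k).ne')
    obtain ⟨h, hh, h1⟩ : ∃ h ∈ H, h ≠ 1 := by
      by_contra! hcon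
      have hb : H = ⊥ := (Subgroup.eq_bot_iff_forall H).2 hcon
      rw [hb, Subgroup.card_bot] at hk
      exact absurd hk.symm (Nat.one_lt_pow hk0.ne' hp.one_lt).ne'
    obtain ⟨x, hx⟩ : ∃ x, h x ≠ x := by
      by_contra! hcon
      exact h1 (Equiv.ext hcon)
    have hxS : x ∈ S := by
      by_contra hxS
      exact hx (hf h hh x hxS)
    have horb : MulAction.orbit H x ⊆ S := by
      rintro _ ⟨g, rfl⟩
      by_contra hg
      have h2 := hf _ (H.inv_mem g.2) _ hg
      have h3 : (g : Equiv.Perm α) x ∉ S := hg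
      change (g : Equiv.Perm α)⁻¹ ((g : Equiv.Perm α) x) = (g : Equiv.Perm α) x at h2
      rw [← Equiv.Perm.mul_apply, inv_mul_cancel, Equiv.Perm.one_apply] at h2
      exact h3 (h2 ▸ hxS)
    -- Split off the orbit `O` of a moved point, of size `p ^ i ≥ p * i`. Since `H` is abelian, the
    -- stabilizer `T` fixes `O` pointwise, so induction applies to `T` on `S \ O`.
    set O := S.filter (· ∈ MulAction.orbit H x) with hO
    have hOc : (O : Set α) = MulAction.orbit H x := by
      ext y
      simp only [hO, Finset.coe_filter, Set.mem_ofPred_eq]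
      exact ⟨fun h => h.2, fun h => ⟨horb h, h⟩⟩
    set T := MulAction.stabilizer H x with hT
    have hcard : Nat.card T * O.card = p ^ k := by
      rw [← hk, ← T.card_mul_index, hT, MulAction.index_stabilizer, ← hOc, Set.ncard_coe_finset]
    obtain ⟨j, hj, hTj⟩ := (Nat.dvd_prime_pow hp).1 (Dvd.intro _ hcard)
    obtain ⟨i, rfl⟩ := Nat.exists_eq_add_of_le hj
    have hOi : O.card = p ^ i := by
      rw [hTj, pow_add] at hcard
      exact Nat.eq_of_mul_eq_mul_left (pow_pos hp.pos j) hcard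
    have hle : p * i ≤ p ^ i := by
      cases i with
      | zero => simp
      | succ i =>
        rw [pow_succ, mul_comm]
        exact Nat.mul_le_mul_right _ (Nat.lt_pow_self hp.one_lt)
    have hOS : O ⊆ S := Finset.filter_subset _ _
    have hxO : x ∈ O := Finset.mem_filter.2 ⟨hxS, MulAction.mem_orbit_self x⟩
    have hsub : S \ O ⊂ S := Finset.sdiff_ssubset hOS ⟨x, hxO⟩
    have key := ih _ hsub (T.map H.subtype) ?_ ?_ j ?_
    · have := Finset.card_sdiff_add_card_eq_card hOS
      rw [mul_add]
      omega
    · rintro _ ⟨a, -, rfl⟩ _ ⟨b, -, rfl⟩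
      exact hc _ a.2 _ b.2
    · rintro _ ⟨a, ha, rfl⟩ y hy
      by_cases hyS : y ∈ S
      · have hyO : y ∈ O := by
          by_contra hyO
          exact hy (Finset.mem_sdiff.2 ⟨hyS, hyO⟩)
        obtain ⟨g, rfl⟩ := (Finset.mem_filter.1 hyO).2
        have hax : (a : Equiv.Perm α) x = x := ha
        change ((a : Equiv.Perm α) * (g : Equiv.Perm α)) x = (g : Equiv.Perm α) x
        rw [hc _ a.2 _ g.2, Equiv.Perm.mul_apply, hax]
      · exact hf _ a.2 y hyS
    · rw [Subgroup.card_map_of_injective H.subtype_injective, hTj]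

theorem mul_le_minDegree {G : Type*} [CommGroup G] {p k : ℕ} (hp : p.Prime)
    (hG : Nat.card G = p ^ k) : p * k ≤ minDegree G := by
  have : Finite G := Nat.finite_of_card_ne_zero (by rw [hG]; exact (pow_pos hp.pos k).ne')
  obtain ⟨f, hf⟩ := (minDegree_isLeast G).1
  have := mul_le_card_of_commute hp Finset.univ f.range
    (by rintro _ ⟨a, rfl⟩ _ ⟨b, rfl⟩; rw [← map_mul, mul_comm, map_mul])
    (by simp) k (by rw [← hG]; exact (Nat.card_congr (f.ofInjective hf).toEquiv).symm)
  simpa using this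

theorem minDegree_cyc {p : ℕ} (hp : p.Prime) : minDegree (Cyc p) = p := by
  have : NeZero p := ⟨hp.ne_zero⟩
  have hcard : Nat.card (Cyc p) = p := by simp [Nat.card_eq_fintype_card]
  apply le_antisymm
  · exact (minDegree_le_card (MulAction.toPermHom (Cyc p) (Cyc p))
      MulAction.toPerm_injective).trans hcard.le
  · simpa using mul_le_minDegree (k := 1) hp (hcard.trans (pow_one p).symm)

/-! ### The degree of the wreath product. -/

/-- The imprimitive action of the wreath product on `n` copies of `C_m`. -/
def wreathToPerm (m n : ℕ) : Wreath m n →* Equiv.Perm (Fin n × Cyc m) where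
  toFun w :=
    { toFun := fun x => (w.right x.1, w.left (w.right x.1) * x.2)
      invFun := fun x => (w.right⁻¹ x.1, (w.left x.1)⁻¹ * x.2)
      left_inv := fun x => by simp
      right_inv := fun x => by simp }
  map_one' := by ext x <;> simp
  map_mul' a b := by
    ext x
    · simp
    · change a.left _ * b.left (a.right⁻¹ (a.right (b.right x.1))) * x.2 = a.left _ * (b.left _ * x.2)
      rw [← Equiv.Perm.mul_apply, inv_mul_cancel, Equiv.Perm.one_apply, mul_assoc]
      rfl

theorem wreathToPerm_injective (m n : ℕ) : Function.Injective (wreathToPerm m n) := by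
  intro a b hab
  have h (i : Fin n) : (a.right i, a.left (a.right i) * 1) = (b.right i, b.left (b.right i) * 1) :=
    congrArg (fun f : Equiv.Perm (Fin n × Cyc m) => f (i, 1)) hab
  have hr : a.right = b.right := Equiv.ext fun i => congrArg Prod.fst (h i)
  refine SemidirectProduct.ext (funext fun i => ?_) hr
  have := congrArg Prod.snd (h (a.right⁻¹ i))
  rw [← hr] at this
  simpa using this

instance (m n : ℕ) [NeZero m] : Finite (Wreath m n) :=
  Finite.of_injective _ SemidirectProduct.equivProd.injective

theorem minDegree_wreath {p q : ℕ} (hp : p.Prime) : minDegree (Wreath p q) = p * q := by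
  have : NeZero p := ⟨hp.ne_zero⟩
  apply le_antisymm
  · refine (minDegree_le_card _ (wreathToPerm_injective p q)).trans ?_
    simp [Nat.card_eq_fintype_card, mul_comm]
  · refine (mul_le_minDegree (G := Fin q → Cyc p) hp ?_).trans
      (minDegree_le_of_injective _ SemidirectProduct.inl_injective)
    simp [Nat.card_eq_fintype_card]

/-! ### Irreducibility of the sum-zero module. -/

section AlternatingModule

variable {ι K : Type*} [Fintype ι] [DecidableEq ι] [Field K]

/-- If `|ι| ≥ 5` is invertible in `K`, the alternating group on `ι` acts irreducibly on the vectors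
of sum zero in `K ^ ι`. -/
theorem mem_of_alternating_invariant (h5 : 5 ≤ Fintype.card ι) (hK : (Fintype.card ι : K) ≠ 0)
    (B : Submodule K (ι → K)) (hB : ∀ v ∈ B, ∑ i, v i = 0)
    (hinv : ∀ σ ∈ alternatingGroup ι, ∀ v ∈ B, v ∘ σ ∈ B) (hne : B ≠ ⊥)
    (u : ι → K) (hu : ∑ i, u i = 0) : u ∈ B := by
  have hex (s : Finset ι) (hs : s.card < 5) : ∃ x, x ∉ s := by
    by_contra! hcon
    have := Finset.card_le_card (fun x _ => hcon x : Finset.univ ⊆ s)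
    rw [Finset.card_univ] at this
    omega
  have h3 (a b c : ι) (hab : a ≠ b) (hac : a ≠ c) (hbc : b ≠ c) :
      Equiv.swap a b * Equiv.swap a c ∈ alternatingGroup ι :=
    (Equiv.Perm.isThreeCycle_swap_mul_swap_same hab hac hbc).mem_alternatingGroup
  obtain ⟨v, hv, hv0⟩ := B.exists_mem_ne_zero_of_ne_bot hne
  obtain ⟨i, j, hvij⟩ : ∃ i j, v i ≠ v j := by
    by_contra! hcon
    apply hv0
    funext i
    have h := hB v hv
    rw [Finset.sum_congr rfl (fun j _ => hcon j i), Finset.sum_const, Finset.card_univ,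
      nsmul_eq_mul] at h
    exact (mul_eq_zero.1 h).resolve_left hK
  have hij : i ≠ j := fun h => hvij (h ▸ rfl)
  obtain ⟨k, hk⟩ := hex {i, j} ((Finset.card_le_two).trans_lt (by norm_num))
  obtain ⟨l, hl⟩ := hex {i, j, k} ((Finset.card_le_three).trans_lt (by norm_num))
  obtain ⟨m, hm⟩ := hex {i, j, k, l} ((Finset.card_le_four).trans_lt (by norm_num))
  simp only [Finset.mem_insert, Finset.mem_singleton, not_or] at hk hl hm
  obtain ⟨hki, hkj⟩ := hk
  obtain ⟨hli, hlj, hlk⟩ := hl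
  obtain ⟨hmi, hmj, hmk, hml⟩ := hm
  -- `w` is supported on `{i, j, k}`
  set w : ι → K := v - v ∘ (Equiv.swap k j * Equiv.swap k i : Equiv.Perm ι) with hw
  have hwB : w ∈ B := B.sub_mem hv (hinv _ (h3 k j i hkj hki hij.symm) v hv)
  have hwi : w i ≠ 0 := by
    have : w i = v i - v j := by simp [hw]
    rw [this]
    exact sub_ne_zero.2 hvij
  have hw0 (x : ι) (hxi : x ≠ i) (hxj : x ≠ j) (hxk : x ≠ k) : w x = 0 := by
    simp [hw, Equiv.swap_apply_of_ne_of_ne, hxi, hxj, hxk]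
  -- This 3-cycle on `i`, `l`, `m` meets the support of `w` only in `i`, so the values at `j` and
  -- `k` cancel.
  set z : ι → K := w - w ∘ (Equiv.swap m i * Equiv.swap m l : Equiv.Perm ι) with hz
  have hzB : z ∈ B := B.sub_mem hwB (hinv _ (h3 m i l hmi hml (Ne.symm hli)) w hwB)
  have hzeq : z = w i • (Pi.single i 1 - Pi.single l 1 : ι → K) := by
    funext x
    have hwl := hw0 l hli hlj hlk
    have hwm := hw0 m hmi hmj hmk
    by_cases hxi : x = i
    · subst hxi
      simp [hz, hwm, Equiv.swap_apply_of_ne_of_ne, Ne.symm hmi, Ne.symm hli]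
    by_cases hxl : x = l
    · subst hxl
      simp [hz, hwl, hxi]
    by_cases hxm : x = m
    · subst hxm
      simp [hz, hwm, hwl, Equiv.swap_apply_of_ne_of_ne, hli, Ne.symm hml, hxi, hxl]
    · simp [hz, Equiv.swap_apply_of_ne_of_ne, hxi, hxl, hxm]
  have hil : (Pi.single i 1 - Pi.single l 1 : ι → K) ∈ B := by
    rw [hzeq] at hzB
    exact (B.smul_mem_iff hwi).1 hzB
  have hall (a b : ι) : (Pi.single a 1 - Pi.single b 1 : ι → K) ∈ B := by
    by_cases hab : a = b
    · subst hab
      simp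
    -- Double transitivity of `Alt(ι)`: an odd `τ` is corrected by `swap k m`, which fixes `i` and
    -- `l`.
    obtain ⟨σ, hσ, hσa, hσb⟩ : ∃ σ ∈ alternatingGroup ι, σ a = i ∧ σ b = l := by
      set τ := Equiv.swap (Equiv.swap a i b) l * Equiv.swap a i with hτ
      have h1 : τ a = i := by
        have hne1 : i ≠ Equiv.swap a i b := by
          intro h
          have h' := congrArg (Equiv.swap a i) h
          simp only [Equiv.swap_apply_right, Equiv.swap_apply_self] at h'
          exact hab h'
        simp [hτ, Equiv.swap_apply_of_ne_of_ne hne1 (Ne.symm hli)]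
      have h2 : τ b = l := by simp [hτ]
      rcases Int.units_eq_one_or (Equiv.Perm.sign τ) with hs | hs
      · exact ⟨τ, Equiv.Perm.mem_alternatingGroup.2 hs, h1, h2⟩
      · refine ⟨Equiv.swap k m * τ, ?_, ?_, ?_⟩
        · rw [Equiv.Perm.mem_alternatingGroup, map_mul, hs, Equiv.Perm.sign_swap (Ne.symm hmk),
            neg_mul_neg, one_mul]
        · rw [Equiv.Perm.mul_apply, h1,
            Equiv.swap_apply_of_ne_of_ne (Ne.symm hki) (Ne.symm hmi)]
        · rw [Equiv.Perm.mul_apply, h2, Equiv.swap_apply_of_ne_of_ne hlk (Ne.symm hml)]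
    have h := hinv σ hσ _ hil
    convert h using 1
    funext x
    have e1 : σ x = i ↔ x = a := by rw [← hσa, σ.injective.eq_iff]
    have e2 : σ x = l ↔ x = b := by rw [← hσb, σ.injective.eq_iff]
    simp [Pi.single_apply, e1, e2]
  have hdecomp : u = ∑ a, u a • (Pi.single a 1 - Pi.single i 1 : ι → K) := by
    simp only [smul_sub, Finset.sum_sub_distrib, ← Finset.sum_smul, hu, zero_smul, sub_zero]
    exact pi_eq_sum_univ' u |>.trans (Finset.sum_congr rfl fun a _ => rfl)
  rw [hdecomp]
  exact B.sum_mem fun a _ => B.smul_mem _ (hall a i)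

end AlternatingModule

/-- If `3` is invertible in `K` and `K` has no primitive cube root of unity, rotation acts
irreducibly on the vectors of sum zero in `K ^ 3`. -/
theorem mem_of_rotate_invariant {K : Type*} [Field K] (hK : (3 : K) ≠ 0)
    (hroot : ∀ x : K, x ^ 3 = 1 → x = 1) (B : Submodule K (Fin 3 → K))
    (hB : ∀ v ∈ B, ∑ i, v i = 0) (hinv : ∀ v ∈ B, v ∘ finRotate 3 ∈ B) (hne : B ≠ ⊥)
    (u : Fin 3 → K) (hu : ∑ i, u i = 0) : u ∈ B := by
  obtain ⟨v, hv, hv0⟩ := B.exists_mem_ne_zero_of_ne_bot hne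
  have hs := hB v hv
  have hv' := hinv v hv
  simp only [Fin.sum_univ_three] at hs hu
  have hc : v 2 = -v 0 - v 1 := by linear_combination hs
  -- The determinant of the first two coordinates of `v` and its rotation. It equals `-(v 0 ^ 2 + v
  -- 0 * v 1 + v 1 ^ 2)`, whose vanishing would make `v 0 / v 1` a nontrivial cube root of unity.
  -- The coefficients in `hdecomp` are then Cramer's rule.
  have hD : v 0 * v 2 - v 1 ^ 2 ≠ 0 := by
    intro h
    have hq : v 0 ^ 2 + v 0 * v 1 + v 1 ^ 2 = 0 := by rw [hc] at h; linear_combination -h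
    have hcube : v 0 ^ 3 = v 1 ^ 3 := by linear_combination (v 0 - v 1) * hq
    have h1 : v 1 = 0 := by
      by_contra h1
      have h01 : v 0 = v 1 := by
        have := hroot (v 0 / v 1) (by rw [div_pow, hcube, div_self (pow_ne_zero 3 h1)])
        rwa [div_eq_one_iff_eq h1] at this
      rw [h01] at hq
      have : 3 * v 1 ^ 2 = 0 := by linear_combination hq
      exact (mul_ne_zero hK (pow_ne_zero 2 h1)) this
    have h0 : v 0 = 0 := by
      rw [h1] at hcube
      simpa using hcube
    apply hv0
    funext x
    fin_cases x
    · exact h0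
    · exact h1
    · simp [hc, h0, h1]
  have hu2 : u 2 = -u 0 - u 1 := by linear_combination hu
  have hdecomp : u = ((u 0 * v 2 - u 1 * v 1) / (v 0 * v 2 - v 1 ^ 2)) • v +
      ((v 0 * u 1 - v 1 * u 0) / (v 0 * v 2 - v 1 ^ 2)) • (v ∘ finRotate 3) := by
    have r0 : finRotate 3 0 = 1 := rfl
    have r1 : finRotate 3 1 = 2 := rfl
    have r2 : finRotate 3 2 = 0 := rfl
    funext x
    fin_cases x
    · simp only [Fin.zero_eta, Pi.add_apply, Pi.smul_apply, smul_eq_mul, Function.comp_apply, r0]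
      rw [div_mul_eq_mul_div, div_mul_eq_mul_div, ← add_div, eq_div_iff hD]
      ring
    · simp only [Fin.mk_one, Pi.add_apply, Pi.smul_apply, smul_eq_mul, Function.comp_apply, r1]
      rw [div_mul_eq_mul_div, div_mul_eq_mul_div, ← add_div, eq_div_iff hD]
      ring
    · simp only [Fin.reduceFinMk, Pi.add_apply, Pi.smul_apply, smul_eq_mul, Function.comp_apply,
        r2]
      rw [div_mul_eq_mul_div, div_mul_eq_mul_div, ← add_div, eq_div_iff hD, hu2, hc]
      ring
  rw [hdecomp]
  exact B.add_mem (B.smul_mem _ hv) (B.smul_mem _ hv')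

theorem ZMod.eq_one_of_pow_three_eq_one {p : ℕ} [Fact p.Prime] (h3 : p % 3 ≠ 1) (x : ZMod p)
    (hx : x ^ 3 = 1) : x = 1 := by
  have hx0 : x ≠ 0 := by rintro rfl; simp at hx
  have hp := (Fact.out : p.Prime).two_le
  have h1 : orderOf x ∣ 3 := orderOf_dvd_of_pow_eq_one hx
  have h2 : orderOf x ∣ p - 1 := orderOf_dvd_of_pow_eq_one (ZMod.pow_card_sub_one_eq_one hx0)
  rcases (Nat.dvd_prime Nat.prime_three).1 h1 with h | h
  · exact orderOf_eq_one_iff.1 h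
  · rw [h] at h2
    omega

/-- For `q = 3` the group `Alt(3)` is generated by the rotation. The excluded case is a genuine
exception: a primitive cube root of unity `ω` gives the invariant line through `(1, ω, ω²)`. -/
theorem mem_of_alternating_invariant_zmod {p q : ℕ} (hp : p.Prime) (hq : q.Prime)
    (hq2 : Odd q) (hpq : p ≠ q) (hex : ¬ (q = 3 ∧ p % 3 = 1))
    (B : Submodule (ZMod p) (Fin q → ZMod p)) (hB : ∀ v ∈ B, ∑ i, v i = 0)
    (hinv : ∀ σ ∈ alternatingGroup (Fin q), ∀ v ∈ B, v ∘ σ ∈ B) (hne : B ≠ ⊥)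
    (u : Fin q → ZMod p) (hu : ∑ i, u i = 0) : u ∈ B := by
  have : Fact p.Prime := ⟨hp⟩
  have hK : (q : ZMod p) ≠ 0 := by
    rw [Ne, ZMod.natCast_eq_zero_iff]
    exact fun h => hpq ((Nat.prime_dvd_prime_iff_eq hp hq).1 h)
  rcases eq_or_ne q 3 with rfl | hq3
  · refine mem_of_rotate_invariant (by exact_mod_cast hK)
      (ZMod.eq_one_of_pow_three_eq_one fun h => hex ⟨rfl, h⟩) B hB
      (fun v hv => hinv _ ?_ v hv) hne u hu
    rw [Equiv.Perm.mem_alternatingGroup]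
    decide
  · refine mem_of_alternating_invariant ?_ (by simpa using hK) B hB hinv hne u hu
    have := hq.two_le
    obtain ⟨k, rfl⟩ := hq2
    rw [Fintype.card_fin]
    omega

/-! ### Subgroups of small index in `Sym(q)`. -/

/-- A subgroup of `Sym(q)` of index less than the odd prime `q` contains `Alt(q)`. -/
theorem alternatingGroup_le_of_index_lt_prime {q : ℕ} (hq : q.Prime) (hq2 : Odd q)
    (L : Subgroup (Equiv.Perm (Fin q))) (hL : L.index < q) : alternatingGroup (Fin q) ≤ L := by
  -- Some `g ^ n` with `0 < n ≤ L.index < q` lies in `L`; as `n` is prime to `q`, `g` is a power of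
  -- it.
  have hmem (g : Equiv.Perm (Fin q)) (hg : g ^ q = 1) : g ∈ L := by
    obtain ⟨n, hn0, hnL, hn⟩ := L.exists_pow_mem_of_index_ne_zero L.index_ne_zero_of_finite g
    have hcop : Nat.Coprime (orderOf g) n :=
      Nat.Coprime.coprime_dvd_left (orderOf_dvd_of_pow_eq_one hg)
        ((hq.coprime_iff_not_dvd).2 fun h => by have := Nat.le_of_dvd hn0 h; omega)
    obtain ⟨m, hm⟩ := exists_pow_eq_self_of_coprime hcop.symm
    rw [← hm]
    exact L.pow_mem hn m
  rcases eq_or_ne q 3 with rfl | hq3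
  · intro g hg
    rw [Equiv.Perm.mem_alternatingGroup] at hg
    apply hmem
    revert g
    decide
  have h5 : 5 ≤ q := by
    have := hq.two_le
    obtain ⟨k, rfl⟩ := hq2
    omega
  -- A normal subgroup containing a `q`-cycle, hence nontrivial, so it contains `Alt(q)` once `q ≥
  -- 5`.
  set N := Subgroup.normalClosure {g : Equiv.Perm (Fin q) | g ^ q = 1}
  have hNL : N ≤ L := by
    refine (Subgroup.closure_le L).2 fun g hg => hmem g ?_
    obtain ⟨a, ha, hag⟩ := Group.mem_conjugatesOfSet_iff.1 hg
    obtain ⟨c, rfl⟩ := isConj_iff.1 hag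
    rw [conj_pow, show a ^ q = 1 from ha, mul_one, mul_inv_cancel]
  have hrot : finRotate q ∈ N := by
    apply Subgroup.subset_normalClosure
    rw [Set.mem_ofPred_eq]
    have h := cycleType_finRotate_of_le hq.two_le
    have ho : orderOf (finRotate q) = q := by rw [← Equiv.Perm.lcm_cycleType, h]; simp
    exact orderOf_dvd_iff_pow_eq_one.1 ho.dvd
  have hne : Nontrivial N := by
    refine (Subgroup.nontrivial_iff_exists_ne_one N).2 ⟨_, hrot, fun h => ?_⟩
    have h' := cycleType_finRotate_of_le hq.two_le
    rw [h] at h'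
    simp at h'
  exact (Equiv.Perm.alternatingGroup_le_of_normal (by simpa using h5) hne).trans hNL

/-! ### Center, centralizer and direct decomposition. -/

theorem mem_baseA_self {p q : ℕ} (hp : 0 < p) {θ : Fin q → Cyc p} :
    θ ∈ baseA p p q ↔ ∏ i, θ i = 1 := by
  change (∏ i, θ i) ^ (p / p) = 1 ↔ _
  rw [Nat.div_self hp, pow_one]

/-- The product of the coordinates of the base component, as a homomorphism. -/
def wreathProd (m n : ℕ) : Wreath m n →* Cyc m where
  toFun w := ∏ i, w.left i
  map_one' := by simp
  map_mul' a b := by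
    change ∏ i, a.left i * b.left (a.right⁻¹ i) = _
    rw [Finset.prod_mul_distrib, Equiv.prod_comp a.right⁻¹ b.left]

theorem reflGroup_self_eq_ker {p q : ℕ} (hp : 0 < p) : reflGroup p p q = (wreathProd p q).ker := by
  ext w
  exact mem_baseA_self hp

/-- The diagonal embedding of `C_m` in the base group of the wreath product. -/
def diagHom (m n : ℕ) : Cyc m →* Wreath m n :=
  SemidirectProduct.inl.comp (MonoidHom.pi fun _ => MonoidHom.id _)

theorem diagHom_injective (m : ℕ) {n : ℕ} (hn : 0 < n) : Function.Injective (diagHom m n) :=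
  fun _ _ h => congrArg (fun w : Wreath m n => w.left ⟨0, hn⟩) h

theorem zpowers_gammaProd (m n : ℕ) : Subgroup.zpowers (gammaProd m n) = (diagHom m n).range := by
  have h1 : gammaProd m n = diagHom m n (Multiplicative.ofAdd 1) := by
    refine congrArg SemidirectProduct.inl ?_
    exact Finset.univ_prod_mulSingle (fun _ : Fin n => Multiplicative.ofAdd (1 : ZMod m))
  have h2 : Subgroup.zpowers (Multiplicative.ofAdd (1 : ZMod m)) = ⊤ := by
    refine (Subgroup.eq_top_iff' _).2 fun x => ?_
    obtain ⟨z, hz⟩ := ZMod.intCast_surjective x.toAdd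
    refine Subgroup.mem_zpowers_iff.2 ⟨z, ?_⟩
    rw [← ofAdd_zsmul, zsmul_one, hz, ofAdd_toAdd]
  rw [h1, ← MonoidHom.map_zpowers, h2, MonoidHom.range_eq_map]

theorem diagHom_range_le_center (m n : ℕ) :
    (diagHom m n).range ≤ Subgroup.center (Wreath m n) := by
  rintro _ ⟨c, rfl⟩
  refine Subgroup.mem_center_iff.2 fun w => SemidirectProduct.ext (funext fun i => ?_) ?_
  · exact mul_comm (w.left i) c
  · exact (mul_one w.right).trans (one_mul w.right).symm

/-- Commuting with the complement `Sym(n)` already suffices: it makes the base part constant and the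
permutation part central in `Sym(n)`, hence trivial for `n ≥ 3`. -/
theorem centralizer_reflGroup {m p n : ℕ} (hn : 3 ≤ n) :
    Subgroup.centralizer (reflGroup m p n : Set (Wreath m n)) = (diagHom m n).range := by
  refine le_antisymm (fun w hw => ?_)
    ((diagHom_range_le_center m n).trans (Subgroup.center_le_centralizer _))
  have hcomm (σ : Equiv.Perm (Fin n)) : SemidirectProduct.inr σ * w = w * SemidirectProduct.inr σ :=
    Subgroup.mem_centralizer_iff.1 hw _ (baseA m p n).one_mem
  have hleft (σ : Equiv.Perm (Fin n)) (i : Fin n) : w.left (σ⁻¹ i) = w.left i := by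
    have h := congrArg (fun v : Wreath m n => v.left i) (hcomm σ)
    change 1 * w.left (σ⁻¹ i) = w.left i * 1 at h
    rwa [one_mul, mul_one] at h
  have hright (σ : Equiv.Perm (Fin n)) (i : Fin n) : σ (w.right i) = w.right (σ i) :=
    congrArg (fun v : Wreath m n => v.right i) (hcomm σ)
  have hr : w.right = 1 := by
    ext1 i
    by_contra hi
    have hi' : w.right i ≠ i := hi
    obtain ⟨k, hk⟩ : ∃ k, k ∉ ({i, w.right i} : Finset (Fin n)) := by
      by_contra! hcon
      have h1 := Finset.card_le_card (fun x _ => hcon x : Finset.univ ⊆ _)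
      have h2 := (Finset.card_le_two : ({i, w.right i} : Finset (Fin n)).card ≤ 2)
      rw [Finset.card_univ, Fintype.card_fin] at h1
      omega
    simp only [Finset.mem_insert, Finset.mem_singleton, not_or] at hk
    have h := hright (Equiv.swap (w.right i) k) i
    rw [Equiv.swap_apply_left, Equiv.swap_apply_of_ne_of_ne hi'.symm (Ne.symm hk.1)] at h
    exact hk.2 h
  refine ⟨w.left ⟨0, by omega⟩, SemidirectProduct.ext (funext fun i => ?_) hr.symm⟩
  have h := hleft (Equiv.swap i ⟨0, by omega⟩) i
  rw [Equiv.swap_inv, Equiv.swap_apply_left] at h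
  exact h

theorem isInternalDirectProduct_diag_reflGroup {p q : ℕ} (hp : p.Prime) (hq : q.Prime)
    (hpq : p ≠ q) : IsInternalDirectProduct (diagHom p q).range (reflGroup p p q) := by
  have hcop : (Nat.card (Cyc p)).Coprime q := by
    have : NeZero p := ⟨hp.ne_zero⟩
    rw [Nat.card_eq_fintype_card, Fintype.card_multiplicative, ZMod.card]
    exact (Nat.coprime_primes hp hq).2 hpq
  have hprod (c : Cyc p) : wreathProd p q (diagHom p q c) = c ^ q := by
    change ∏ _i : Fin q, c = _
    simp
  rw [reflGroup_self_eq_ker hp.pos]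
  refine ⟨⟨fun x hx g => ?_⟩, inferInstance, ?_, ?_⟩
  · rw [Subgroup.mem_center_iff.1 (diagHom_range_le_center p q hx) g, mul_inv_cancel_right]
    exact hx
  · refine (Subgroup.eq_bot_iff_forall _).2 ?_
    rintro _ ⟨⟨c, rfl⟩, hc⟩
    have h1 : c ^ q = 1 := (hprod c).symm.trans hc
    have : c = 1 := (powCoprime hcop).injective (by simpa using h1)
    rw [this, map_one]
  · refine (Subgroup.eq_top_iff' _).2 fun w => ?_
    -- Dividing `w` by the diagonal element of a `q`-th root of its coordinate product lands in the
    -- kernel.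
    obtain ⟨c, hc⟩ := (powCoprime hcop).surjective (wreathProd p q w)
    have hc' : c ^ q = wreathProd p q w := hc
    rw [← mul_inv_cancel_left (diagHom p q c) w]
    refine Subgroup.mul_mem_sup ⟨c, rfl⟩ ?_
    rw [MonoidHom.mem_ker, map_mul, map_inv, hprod, hc', inv_mul_cancel]

theorem IsInternalDirectProduct.nonempty_mulEquiv {G : Type*} [Group G] {H K : Subgroup G}
    (h : IsInternalDirectProduct H K) (hH : H ≤ Subgroup.center G) : Nonempty (H × K ≃* G) := by
  have comm (m : H) (n : K) : Commute (H.subtype m) (K.subtype n) :=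
    (Subgroup.mem_center_iff.1 (hH m.2) n).symm
  refine ⟨MulEquiv.ofBijective (MonoidHom.noncommCoprod H.subtype K.subtype comm) ⟨?_, ?_⟩⟩
  · rw [MonoidHom.noncommCoprod_injective]
    refine ⟨H.subtype_injective, K.subtype_injective, ?_⟩
    rw [H.range_subtype, K.range_subtype, disjoint_iff]
    exact h.2.2.1
  · rw [← MonoidHom.range_eq_top, MonoidHom.noncommCoprod_range, H.range_subtype, K.range_subtype]
    exact h.2.2.2

/-! ### Subgroups of `G(p,p,q)` and its minimal degree. -/

theorem pow_le_card_baseA {p : ℕ} (hp : p.Prime) (q : ℕ) : p ^ q ≤ Nat.card (baseA p p q) * p := by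
  have : NeZero p := ⟨hp.ne_zero⟩
  let f : (Fin q → Cyc p) →* Cyc p := (wreathProd p q).comp SemidirectProduct.inl
  have hk : baseA p p q = f.ker := by
    ext θ
    exact mem_baseA_self hp.pos
  have h1 : Nat.card f.range ≤ p := by
    refine (Subgroup.card_le_card_group _).trans ?_
    simp [Nat.card_eq_fintype_card]
  have h2 := f.ker.card_mul_index
  rw [Subgroup.index_ker, ← hk] at h2
  have h3 : Nat.card (Fin q → Cyc p) = p ^ q := by simp [Nat.card_eq_fintype_card]
  rw [← h3, ← h2]
  exact Nat.mul_le_mul_left _ h1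

/-- The projection of `G(m,p,n)` on `Sym(n)`. -/
def reflGroupRight (m p n : ℕ) : reflGroup m p n →* Equiv.Perm (Fin n) :=
  SemidirectProduct.rightHom.comp (reflGroup m p n).subtype

/-- The inclusion of `A(m,p,n)` in `G(m,p,n)`. -/
def baseAInclusion (m p n : ℕ) : baseA m p n →* reflGroup m p n :=
  (SemidirectProduct.inl.comp (baseA m p n).subtype).codRestrict _ fun θ => θ.2

theorem baseAInclusion_injective (m p n : ℕ) : Function.Injective (baseAInclusion m p n) :=
  fun _ _ h => Subtype.ext (congrArg (fun w : reflGroup m p n => w.1.left) h)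

theorem range_baseAInclusion (m p n : ℕ) :
    (baseAInclusion m p n).range = (reflGroupRight m p n).ker := by
  ext w
  constructor
  · rintro ⟨θ, rfl⟩
    rfl
  · intro hw
    exact ⟨⟨w.1.left, w.2⟩, Subtype.ext (SemidirectProduct.ext rfl (Eq.symm hw))⟩

theorem reflGroupRight_surjective (m p n : ℕ) : Function.Surjective (reflGroupRight m p n) :=
  fun σ => ⟨⟨SemidirectProduct.inr σ, (baseA m p n).one_mem⟩, rfl⟩

/-- `θ ∘ σ` is the conjugate of `θ` by any lift of `σ⁻¹` to `H`; the base part of the lift is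
irrelevant because the base group is abelian. -/
theorem inl_comp_mem {m p n : ℕ} (H : Subgroup (reflGroup m p n)) {σ : Equiv.Perm (Fin n)}
    (hσ : σ ∈ H.map (reflGroupRight m p n)) {θ : Fin n → Cyc m}
    (hθ : SemidirectProduct.inl θ ∈ H.map (reflGroup m p n).subtype) :
    (SemidirectProduct.inl (θ ∘ σ) : Wreath m n) ∈ H.map (reflGroup m p n).subtype := by
  obtain ⟨h, hh, hhσ⟩ := (H.map (reflGroupRight m p n)).inv_mem hσ
  have hr : (h : Wreath m n).right = σ⁻¹ := hhσ
  have hmem : (h : Wreath m n) ∈ H.map (reflGroup m p n).subtype := ⟨h, hh, rfl⟩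
  have key : (SemidirectProduct.inl (θ ∘ σ) : Wreath m n) * (h : Wreath m n) =
      (h : Wreath m n) * SemidirectProduct.inl θ := by
    refine SemidirectProduct.ext (funext fun i => ?_) ?_
    · change θ (σ i) * h.1.left i = h.1.left i * θ (h.1.right⁻¹ i)
      rw [hr, inv_inv, mul_comm]
    · exact (one_mul h.1.right).trans (mul_one h.1.right).symm
  rw [eq_mul_inv_of_mul_eq key]
  exact Subgroup.mul_mem _ (Subgroup.mul_mem _ hmem hθ) (Subgroup.inv_mem _ hmem)

/-- A subgroup of `G(p,p,q)` that maps onto a group containing `Alt(q)` contains the base group or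
meets it trivially. -/
theorem ker_le_or_inf_ker_eq_bot {p q : ℕ} (hp : p.Prime) (hq : q.Prime) (hq2 : Odd q)
    (hpq : p ≠ q) (hex : ¬ (q = 3 ∧ p % 3 = 1)) (H : Subgroup (reflGroup p p q))
    (hH : alternatingGroup (Fin q) ≤ H.map (reflGroupRight p p q)) :
    (reflGroupRight p p q).ker ≤ H ∨ H ⊓ (reflGroupRight p p q).ker = ⊥ := by
  set M := H.map (reflGroup p p q).subtype with hM
  let toBase : Multiplicative (Fin q → ZMod p) →* Wreath p q :=
    { toFun := fun v => SemidirectProduct.inl fun i => Multiplicative.ofAdd (v.toAdd i)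
      map_one' := rfl
      map_mul' := fun _ _ => SemidirectProduct.ext rfl rfl }
  -- `H ∩ A` in additive notation; an additive subgroup is automatically a `ZMod p`-subspace, so
  -- irreducibility applies.
  let B : Submodule (ZMod p) (Fin q → ZMod p) :=
    AddSubgroup.toZModSubmodule p (Subgroup.toAddSubgroup' (M.comap toBase))
  have hmem (v : Fin q → ZMod p) :
      v ∈ B ↔ (SemidirectProduct.inl fun i => Multiplicative.ofAdd (v i)) ∈ M := Iff.rfl
  have hsum (v : Fin q → ZMod p) : (∏ i, Multiplicative.ofAdd (v i) = 1) ↔ ∑ i, v i = 0 := by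
    rw [← ofAdd_sum]
    exact ofAdd_eq_one
  by_cases hB : B = ⊥
  · right
    refine (Subgroup.eq_bot_iff_forall _).2 ?_
    rintro w ⟨hw, hwK⟩
    rw [SetLike.mem_coe, ← range_baseAInclusion] at hwK
    obtain ⟨θ, rfl⟩ := hwK
    have h0 : (fun i => (θ.1 i).toAdd) ∈ B := (hmem _).2 ⟨_, hw, rfl⟩
    rw [hB, Submodule.mem_bot] at h0
    have : θ = 1 := Subtype.ext (funext fun i => congrFun h0 i)
    rw [this, map_one]
  · left
    intro w hwK
    rw [← range_baseAInclusion] at hwK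
    obtain ⟨θ, rfl⟩ := hwK
    have hu : (fun i => (θ.1 i).toAdd) ∈ B := by
      refine mem_of_alternating_invariant_zmod hp hq hq2 hpq hex B ?_ ?_ hB _ ?_
      · intro v hv
        obtain ⟨h, -, hh⟩ := (hmem v).1 hv
        have := h.2
        rw [show (h : Wreath p q) = _ from hh] at this
        exact (hsum v).1 ((mem_baseA_self hp.pos).1 this)
      · intro σ hσ v hv
        exact inl_comp_mem H (hH hσ) hv
      · exact (hsum _).1 ((mem_baseA_self hp.pos).1 θ.2)
    obtain ⟨h, hh, he⟩ := (hmem _).1 hu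
    have : h = baseAInclusion p p q θ := Subtype.ext he
    exact this ▸ hh

theorem mul_le_index_of_not_ker_le {p q : ℕ} (hp : p.Prime) (hq : q.Prime) (hp2 : Odd p)
    (hq2 : Odd q) (hpq : p ≠ q) (hex : ¬ (q = 3 ∧ p % 3 = 1)) (H : Subgroup (reflGroup p p q))
    (hH : ¬ (reflGroupRight p p q).ker ≤ H) : p * q ≤ H.index := by
  have : NeZero p := ⟨hp.ne_zero⟩
  set φ := reflGroupRight p p q with hφ
  have hcard : Nat.card φ.ker = Nat.card (baseA p p q) := by
    rw [hφ, ← range_baseAInclusion]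
    exact (Nat.card_congr
      (MonoidHom.ofInjective (baseAInclusion_injective p p q)).toEquiv).symm
  have hindex : H.index = H.relIndex φ.ker * (H.map φ).index := by
    rw [Subgroup.index_map, MonoidHom.range_eq_top.2 (reflGroupRight_surjective p p q),
      Subgroup.index_top, mul_one]
    have h1 := Subgroup.relIndex_mul_index (inf_le_left : H ⊓ φ.ker ≤ H)
    have h2 := Subgroup.relIndex_mul_index (inf_le_right : H ⊓ φ.ker ≤ φ.ker)
    have h3 := Subgroup.relIndex_mul_index (le_sup_right : φ.ker ≤ H ⊔ φ.ker)
    rw [Subgroup.inf_relIndex_left] at h1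
    rw [Subgroup.inf_relIndex_right] at h2
    rw [Subgroup.relIndex_sup_right] at h3
    refine Nat.eq_of_mul_eq_mul_left
      (Nat.pos_of_ne_zero (φ.ker.subgroupOf H).index_ne_zero_of_finite) ?_
    change φ.ker.relIndex H * H.index = φ.ker.relIndex H * _
    rw [h1, ← h2, ← h3]
    ring
  rw [hindex]
  rcases lt_or_ge (H.map φ).index q with hlt | hge
  · have halt := alternatingGroup_le_of_index_lt_prime hq hq2 _ hlt
    have hbot := (ker_le_or_inf_ker_eq_bot hp hq hq2 hpq hex H halt).resolve_left hH
    rw [← Subgroup.inf_relIndex_right, hbot, Subgroup.relIndex_bot_left, hcard]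
    have h1 := pow_le_card_baseA hp q
    have hpos : 0 < (H.map φ).index := Nat.pos_of_ne_zero Subgroup.index_ne_zero_of_finite
    refine le_trans ?_ (Nat.le_mul_of_pos_right _ hpos)
    have hp3 : 3 ≤ p := by
      have := hp.two_le
      obtain ⟨k, rfl⟩ := hp2
      omega
    obtain ⟨k, rfl⟩ : ∃ k, q = k + 3 := by
      have := hq.two_le
      obtain ⟨k, rfl⟩ := hq2
      exact ⟨2 * k - 2, by omega⟩
    have h2 : p ^ (k + 2) ≤ Nat.card (baseA p p (k + 3)) := by
      rw [pow_succ] at h1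
      exact Nat.le_of_mul_le_mul_right h1 hp.pos
    refine le_trans ?_ h2
    -- Oddness of `p` is needed: `p = 2`, `k = 0` would fail.
    have h3 : k + 3 ≤ p ^ (k + 1) := by
      have h4 : k < p ^ k := Nat.lt_pow_self hp.one_lt
      rw [pow_succ]
      nlinarith
    rw [pow_succ, mul_comm]
    exact Nat.mul_le_mul_right _ h3
  · refine Nat.mul_le_mul ?_ hge
    -- A proper subgroup of the `p`-group `A` has index at least `p`.
    have h1 : H.relIndex φ.ker ≠ 1 := fun h => hH (Subgroup.relIndex_eq_one.1 h)
    have h2 : H.relIndex φ.ker ∣ p ^ q := by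
      refine (Subgroup.relIndex_dvd_card H φ.ker).trans ?_
      rw [hcard]
      refine (Subgroup.card_subgroup_dvd_card _).trans ?_
      simp [Nat.card_eq_fintype_card]
    obtain ⟨j, -, hj⟩ := (Nat.dvd_prime_pow hp).1 h2
    rw [hj] at h1 ⊢
    exact Nat.le_self_pow (by rintro rfl; simp at h1) p

theorem minDegree_reflGroup {p q : ℕ} (hp : p.Prime) (hq : q.Prime) (hp2 : Odd p)
    (hq2 : Odd q) (hpq : p ≠ q) (hex : ¬ (q = 3 ∧ p % 3 = 1)) :
    minDegree (reflGroup p p q) = p * q := by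
  have : NeZero p := ⟨hp.ne_zero⟩
  apply le_antisymm
  · rw [← minDegree_wreath hp]
    exact minDegree_le_of_injective _ (reflGroup p p q).subtype_injective
  obtain ⟨f, hf⟩ := (minDegree_isLeast (reflGroup p p q)).1
  obtain ⟨θ, hθ⟩ : ∃ θ : baseA p p q, θ ≠ 1 := by
    by_contra! hcon
    have hs : Subsingleton (baseA p p q) := ⟨fun a b => (hcon a).trans (hcon b).symm⟩
    have h1 := pow_le_card_baseA hp q
    rw [Nat.card_of_subsingleton (1 : baseA p p q), one_mul] at h1
    have h2 := Nat.pow_lt_pow_right hp.one_lt hq.one_lt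
    rw [pow_one] at h2
    omega
  have hne : f (baseAInclusion p p q θ) ≠ 1 := fun h => hθ <|
    baseAInclusion_injective p p q <| hf <| by rw [h, map_one, map_one]
  obtain ⟨x, hx⟩ : ∃ x, f (baseAInclusion p p q θ) x ≠ x := by
    by_contra! hcon
    exact hne (Equiv.ext hcon)
  set T := MulAction.stabilizer (Equiv.Perm (Fin (minDegree (reflGroup p p q)))) x with hT
  refine (mul_le_index_of_not_ker_le hp hq hp2 hq2 hpq hex (T.comap f) fun h => hx ?_).trans ?_
  · have : baseAInclusion p p q θ ∈ (reflGroupRight p p q).ker := by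
      rw [← range_baseAInclusion]
      exact ⟨θ, rfl⟩
    exact h this
  -- The index of the stabilizer `T.comap f` is at most that of `T` in the full symmetric group, an
  -- orbit size.
  · rw [Subgroup.index_comap]
    refine (Subgroup.relIndex_le_of_le_right (le_top : f.range ≤ ⊤)
      (Subgroup.index_ne_zero_of_finite (H := T.subgroupOf ⊤))).trans ?_
    rw [Subgroup.relIndex_top_right, hT, MulAction.index_stabilizer]
    exact (Set.ncard_le_card _).trans (Nat.card_fin _).le

theorem mainTheorem4 (p q : ℕ) (hp : p.Prime) (hq : q.Prime) (hp2 : Odd p) (hq2 : Odd q)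
    (hpq : p ≠ q) :
    Subgroup.zpowers (gammaProd p q) ≤ Subgroup.center (Wreath p q) ∧
    Subgroup.centralizer (reflGroup p p q : Set (Wreath p q)) =
      Subgroup.zpowers (gammaProd p q) ∧
    Nonempty (Subgroup.zpowers (gammaProd p q) ≃* Cyc p) ∧
    IsInternalDirectProduct (Subgroup.zpowers (gammaProd p q)) (reflGroup p p q) ∧
    minDegree (Wreath p q) = p * q ∧
    minDegree (Subgroup.zpowers (gammaProd p q)) = p ∧
    minDegree (Subgroup.zpowers (gammaProd p q) × reflGroup p p q) = p * q ∧
    (¬ (q = 3 ∧ p % 3 = 1) →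
      minDegree (reflGroup p p q) = p * q ∧
      minDegree (Subgroup.zpowers (gammaProd p q) × reflGroup p p q) <
        minDegree (Subgroup.zpowers (gammaProd p q)) + minDegree (reflGroup p p q)) := by
  have : NeZero p := ⟨hp.ne_zero⟩
  have hq3 : 3 ≤ q := by
    have := hq.two_le
    obtain ⟨k, rfl⟩ := hq2
    omega
  rw [zpowers_gammaProd]
  have hcenter := diagHom_range_le_center p q
  have hprod := isInternalDirectProduct_diag_reflGroup hp hq hpq
  have e : (diagHom p q).range ≃* Cyc p :=
    (MonoidHom.ofInjective (diagHom_injective p hq.pos)).symm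
  have hγ : minDegree (diagHom p q).range = p := (minDegree_congr e).trans (minDegree_cyc hp)
  obtain ⟨e'⟩ := hprod.nonempty_mulEquiv hcenter
  have hdeg : minDegree ((diagHom p q).range × reflGroup p p q) = p * q :=
    (minDegree_congr e').trans (minDegree_wreath hp)
  refine ⟨hcenter, centralizer_reflGroup hq3, ⟨e⟩, hprod, minDegree_wreath hp, hγ, hdeg,
    fun hex => ?_⟩
  have hG := minDegree_reflGroup hp hq hp2 hq2 hpq hex
  refine ⟨hG, ?_⟩
  rw [hdeg, hγ, hG]
  exact Nat.lt_add_of_pos_left hp.pos
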